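/- **Conventions.** $N$ is a finite-dimensional smooth Hausdorff manifold without boundary. For an $\mathbb{R}^k$-valued one-form $\boldsymbol\eta=\sum_{\beta=1}^k\eta_\beta\otimes e_\beta$, kernels, contractions and $\mathrm{d}\boldsymbol\eta$ are taken componentwise. - $\boldsymbol\eta\in\Omega^1(N,\mathbb{R}^k)$ is a *$k$-contact form* if $\ker\boldsymbol\eta$ is a non-zero distribution of constant corank $k$, $\ker\mathrm{d}\boldsymbol\eta$ is a distribution of constant rank $k$, and $\ker\boldsymbol\eta\cap\ker\mathrm{d}\boldsymbol\eta=0$. - A smooth vector field $Y$ is *$\boldsymbol\eta$-Hamiltonian* if it is a Lie symmetry of $\ker\boldsymbol\eta$, i.e. $[Y,Z]$ takes values in $\ker\boldsymbol\eta$ for every smooth vector field $Z$ with values in $\ker\boldsymbol\eta$; its *$\boldsymbol\eta$-Hamiltonian $k$-function* is $-\iota_Y\boldsymbol\eta$. - A $t$-dependent vector field is a family $X=\{X_t\}_{t\in\mathbb{R}}$ of smooth vector fields. $V^X$ denotes the smallest real Lie algebra of smooth vector fields containing all the $X_t$. $X$ is a *Lie system* if all the $X_t$ lie in some finite-dimensional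 real Lie algebra of smooth vector fields (a Vessiot–Guldberg Lie algebra), i.e. $X_t=\sum_{\alpha=1}^r b_\alpha(t)X_\alpha$ with $X_1,\dots,X_r$ a basis of such a Lie algebra. - $(N,\boldsymbol\eta,X)$ is a *$k$-contact Lie system* if $\boldsymbol\eta$ is a $k$-contact form on $N$ and $X$ is a Lie system such that every element of $V^X$ is $\boldsymbol\eta$-Hamiltonian. - For $\ell\ge 0$ and $a=0,\dots,\ell$ let $\mathrm{pr}_a:N^{\ell+1}\to N$, $(x_{(0)},\dots,x_{(\ell)})\mapsto x_{(a)}$. The *diagonal prolongation* of a vector field $Y$ on $N$ is the vector field $Y^{[\ell+1]}(x_{(0)},\dots,x_{(\ell)})=(Y(x_{(0)}),\dots,Y(x_{(\ell)}))$ on $N^{\ell+1}$; for a $t$-dependent vector field, $(X^{[\ell+1]})_t=(X_t)^{[\ell+1]}$. **Proposition.** Let $(N,\boldsymbol\eta,X)$ be a $k$-contact Lie system and $\ell\ge 0$. Put $$\boldsymbol\eta_{N^{\ell+1}}=\sum_{a=0}^{\ell}\sum_{\beta=1}^{k}(\mathrm{pr}_a^*\eta_\beta)\otimes e_{ak+\beta}\in\Omega^1(N^{\ell+1},\mathbb{R}^{k(\ell+1)}).$$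 Then: 1. $\boldsymbol\eta_{N^{\ell+1}}$ is a $k(\ell+1)$-contact form on $N^{\ell+1}$. 2. If $Y$ is an $\boldsymbol\eta$-Hamiltonian vector field on $N$ with $\boldsymbol\eta$-Hamiltonian $k$-function $\boldsymbol h=\sum_\beta h_\beta e_\beta$, then $Y^{[\ell+1]}$ is an $\boldsymbol\eta_{N^{\ell+1}}$-Hamiltonian vector field, and its $\boldsymbol\eta_{N^{\ell+1}}$-Hamiltonian $k(\ell+1)$-function is $\sum_{a=0}^{\ell}\sum_{\beta=1}^{k}(\mathrm{pr}_a^*h_\beta)\,e_{ak+\beta}$. 3. $(N^{\ell+1},\boldsymbol\eta_{N^{\ell+1}},X^{[\ell+1]})$ is a $k(\ell+1)$-contact Lie system. If moreover $(t,x)\mapsto X_t(x)$ is smooth on $\mathbb{R}\times N$, then $X^{[\ell+1]}$ is smooth on $\mathbb{R}\times N^{\ell+1}$. -/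

import Mathlib

open scoped Manifold ContDiff Topology

noncomputable section

namespace KContact

/-! ### Vector fields and one-forms -/

section Basic

variable {E : Type*} [NormedAddCommGroup E] [NormedSpace ℝ E] {H : Type*} [TopologicalSpace H]
  (I : ModelWithCorners ℝ E H) {M : Type*} [TopologicalSpace M] [ChartedSpace H M]

/-- A smooth vector field on `M`: a smooth section of the tangent bundle. -/
def IsSmoothVectorField [IsManifold I ∞ M] (X : ∀ x : M, TangentSpace I x) : Prop :=
  ContMDiff I I.tangent ∞ fun x => (⟨x, X x⟩ : TangentBundle I M)

/-- A smooth one-form on `M` with values in `F`: a smooth section of the vector bundle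
`Hom(TM, M × F)`. -/
def IsSmoothOneForm [IsManifold I ∞ M] {F : Type*} [NormedAddCommGroup F] [NormedSpace ℝ F]
    (η : ∀ x : M, TangentSpace I x →L[ℝ] F) : Prop :=
  ContMDiff I (I.prod 𝓘(ℝ, E →L[ℝ] F)) ∞ fun x =>
    Bundle.TotalSpace.mk' (E →L[ℝ] F)
      (E := fun x : M => TangentSpace I x →L[ℝ] Bundle.Trivial M F x) x (η x)

/-- The local expression of an `F`-valued one-form in the preferred chart at `x`: its pull-back to
the model space along the inverse of that chart. -/
def localForm {F : Type*} [NormedAddCommGroup F] [NormedSpace ℝ F]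
    (η : ∀ x : M, TangentSpace I x →L[ℝ] F) (x : M) (y : E) : E →L[ℝ] F :=
  (η ((extChartAt I x).symm y)).comp
    (mfderivWithin 𝓘(ℝ, E) I (extChartAt I x).symm (Set.range I) y)

/-- The exterior derivative of an `F`-valued one-form at `x`: the exterior derivative of its local
expression in the preferred chart at `x`, pulled back to `T_x M` along that chart. -/
def extDerivOneForm {F : Type*} [NormedAddCommGroup F] [NormedSpace ℝ F]
    (η : ∀ x : M, TangentSpace I x →L[ℝ] F) (x : M) : TangentSpace I x [⋀^Fin 2]→L[ℝ] F :=
  (extDerivWithin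
      (fun y : E => ContinuousAlternatingMap.ofSubsingleton ℝ E F (0 : Fin 1) (localForm I η x y))
      (Set.range I) (extChartAt I x x)).compContinuousLinearMap
    (mfderiv I 𝓘(ℝ, E) (extChartAt I x) x)

/-- The kernel at `x` of the exterior derivative of `η`: all `v ∈ T_x M` with `ι_v dη = 0`. -/
def kerExtDeriv {F : Type*} [NormedAddCommGroup F] [NormedSpace ℝ F]
    (η : ∀ x : M, TangentSpace I x →L[ℝ] F) (x : M) : Submodule ℝ (TangentSpace I x) where
  carrier := {v | ∀ w : TangentSpace I x, extDerivOneForm I η x ![v, w] = 0}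
  zero_mem' := fun w => (extDerivOneForm I η x).map_coord_zero (0 : Fin 2) rfl
  add_mem' := fun {a b} ha hb w => by
    have h := (extDerivOneForm I η x).toAlternatingMap.toMultilinearMap.cons_add ![w] a b
    exact h.trans ((congrArg₂ (· + ·) (ha w) (hb w)).trans (add_zero 0))
  smul_mem' := fun c a ha w => by
    have h := (extDerivOneForm I η x).toAlternatingMap.toMultilinearMap.cons_smul ![w] c a
    exact h.trans ((congrArg (c • ·) (ha w)).trans (smul_zero c))

/-! ### `k`-contact forms and Hamiltonian vector fields -/

/-- `η` is a `k`-contact form on `M`: a smooth `ℝ^k`-valued one-form such that `ker η` is a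
non-zero distribution of constant corank `k`, `ker dη` is a distribution of constant rank `k`, and
`ker η ∩ ker dη = 0`. -/
structure IsKContactForm [IsManifold I ∞ M] {k : ℕ}
    (η : ∀ x : M, TangentSpace I x →L[ℝ] (Fin k → ℝ)) : Prop where
  smooth : IsSmoothOneForm I η
  ker_ne_bot : ∀ x, LinearMap.ker (η x : TangentSpace I x →ₗ[ℝ] (Fin k → ℝ)) ≠ ⊥
  corank_ker : ∀ x,
    Module.finrank ℝ (TangentSpace I x ⧸
      LinearMap.ker (η x : TangentSpace I x →ₗ[ℝ] (Fin k → ℝ))) = k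
  rank_kerExtDeriv : ∀ x, Module.finrank ℝ (kerExtDeriv I η x) = k
  ker_inf_kerExtDeriv : ∀ x,
    LinearMap.ker (η x : TangentSpace I x →ₗ[ℝ] (Fin k → ℝ)) ⊓ kerExtDeriv I η x = ⊥

/-- `X` is an `η`-Hamiltonian vector field: a smooth vector field that is a Lie symmetry of the
distribution `ker η`, i.e. `[X, Y]` takes values in `ker η` whenever the smooth vector field `Y`
does. -/
def IsHamiltonianVectorField [IsManifold I ∞ M] {k : ℕ}
    (η : ∀ x : M, TangentSpace I x →L[ℝ] (Fin k → ℝ)) (X : ∀ x : M, TangentSpace I x) : Prop :=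
  IsSmoothVectorField I X ∧
    ∀ Y : (∀ x : M, TangentSpace I x), IsSmoothVectorField I Y → (∀ x, η x (Y x) = 0) →
      ∀ x, η x (VectorField.mlieBracket I X Y x) = 0

/-- The `η`-Hamiltonian `k`-function `-ι_X η` of an `η`-Hamiltonian vector field `X`. -/
def hamiltonianFunction {k : ℕ} (η : ∀ x : M, TangentSpace I x →L[ℝ] (Fin k → ℝ))
    (X : ∀ x : M, TangentSpace I x) (x : M) : Fin k → ℝ :=
  -η x (X x)

/-! ### Lie systems -/

/-- `V` is a real Lie algebra of smooth vector fields on `M`, with the Lie bracket of vector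
fields. -/
def IsLieAlgebraOfVectorFields [IsManifold I ∞ M]
    (V : Submodule ℝ (∀ x : M, TangentSpace I x)) : Prop :=
  (∀ Y ∈ V, IsSmoothVectorField I Y) ∧ ∀ Y ∈ V, ∀ Z ∈ V, VectorField.mlieBracket I Y Z ∈ V

/-- The smallest Lie algebra `V^X` of vector fields that contains all the vector fields `X_t` of a
`t`-dependent vector field `X`. -/
def smallestLieAlgebra [IsManifold I ∞ M] (X : ℝ → ∀ x : M, TangentSpace I x) :
    Submodule ℝ (∀ x : M, TangentSpace I x) :=
  sInf {V | IsLieAlgebraOfVectorFields I V ∧ ∀ t, X t ∈ V}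

/-- A `t`-dependent vector field `X` is a Lie system: it takes values in a finite-dimensional real
Lie algebra `V` of smooth vector fields (a Vessiot--Guldberg Lie algebra). In terms of a basis
`X_1, …, X_r` of `V`, this says `X_t = ∑ b_α(t) X_α` for some functions `b_α` of `t`. -/
def IsLieSystem [IsManifold I ∞ M] (X : ℝ → ∀ x : M, TangentSpace I x) : Prop :=
  ∃ V : Submodule ℝ (∀ x : M, TangentSpace I x),
    IsLieAlgebraOfVectorFields I V ∧ FiniteDimensional ℝ V ∧ ∀ t, X t ∈ V

/-- `(M, η, X)` is a `k`-contact Lie system. -/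
structure IsKContactLieSystem [IsManifold I ∞ M] {k : ℕ}
    (η : ∀ x : M, TangentSpace I x →L[ℝ] (Fin k → ℝ)) (X : ℝ → ∀ x : M, TangentSpace I x) :
    Prop where
  isKContactForm : IsKContactForm I η
  isLieSystem : IsLieSystem I X
  isHamiltonian : ∀ Y ∈ smallestLieAlgebra I X, IsHamiltonianVectorField I η Y

end Basic

/-! ### The manifold `N^{ℓ+1}` and diagonal prolongations -/

section Prolongation

variable {E : Type*} [NormedAddCommGroup E] [NormedSpace ℝ E] {H : Type*} [TopologicalSpace H]
  (I : ModelWithCorners ℝ E H) {N : Type*} [TopologicalSpace N] [ChartedSpace H N]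

/-- The model of the product manifold `N^{ℓ+1} = (Fin (ℓ + 1) → N)`. -/
abbrev powModel (ℓ : ℕ) :
    ModelWithCorners ℝ (Fin (ℓ + 1) → E) (ModelPi fun _ : Fin (ℓ + 1) => H) :=
  ModelWithCorners.pi fun _ : Fin (ℓ + 1) => I

/-- `N^{ℓ+1}`, with the product charts, is a manifold. -/
instance isManifold_pow (n : WithTop ℕ∞) [IsManifold I n N] (ℓ : ℕ) :
    IsManifold (powModel I ℓ) n (Fin (ℓ + 1) → N) := by
  refine isManifold_of_contDiffOn _ _ _ ?_
  rintro _ _ ⟨e, he, rfl⟩ ⟨e', he', rfl⟩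
  rw [contDiffOn_pi]
  intro i
  have h := (contDiffGroupoid n I).compatible (he i trivial) (he' i trivial)
  rw [contDiffGroupoid, mem_groupoid_of_pregroupoid] at h
  have h1 : ContDiffOn ℝ n (I ∘ ((e i).symm ≫ₕ e' i) ∘ I.symm)
    (I.symm ⁻¹' ((e i).symm ≫ₕ e' i).source ∩ Set.range I) := h.1
  refine h1.comp (contDiff_apply ℝ E i).contDiffOn ?_
  rintro y ⟨⟨hy1, hy2⟩, y0, rfl⟩
  exact ⟨⟨hy1 i trivial, hy2 i trivial⟩, y0 i, rfl⟩

/-- The diagonal prolongation to `N^{ℓ+1}` of a vector field `X` on `N`: its value at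
`(x_0, …, x_ℓ)` is `(X(x_0), …, X(x_ℓ))` in `T_{x_0} N × ⋯ × T_{x_ℓ} N = T_x N^{ℓ+1}`. -/
def diagonalProlongation (ℓ : ℕ) (X : ∀ x : N, TangentSpace I x) (x : Fin (ℓ + 1) → N) :
    TangentSpace (powModel I ℓ) x :=
  fun a : Fin (ℓ + 1) => (X (x a) : E)

/-- The prolongation `X^{[ℓ+1]}` projects to `X` under each of the projections `N^{ℓ+1} → N`. -/
theorem mfderiv_proj_diagonalProlongation (ℓ : ℕ) (X : ∀ x : N, TangentSpace I x)
    (a : Fin (ℓ + 1)) (x : Fin (ℓ + 1) → N) :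
    mfderiv (powModel I ℓ) I (fun y : Fin (ℓ + 1) → N => y a) x
      (diagonalProlongation I ℓ X x) = X (x a) := by
  have h : HasMFDerivAt (powModel I ℓ) I (fun y : Fin (ℓ + 1) → N => y a) x
      (ContinuousLinearMap.proj (R := ℝ) (φ := fun _ : Fin (ℓ + 1) => E) a) := by
    refine ⟨(continuous_apply a).continuousAt, ?_⟩
    have h' : HasFDerivWithinAt (fun y : Fin (ℓ + 1) → E => y a)
        (ContinuousLinearMap.proj (R := ℝ) (φ := fun _ : Fin (ℓ + 1) => E) a)
        (Set.range (powModel I ℓ)) (extChartAt (powModel I ℓ) x x) :=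
      (ContinuousLinearMap.proj (R := ℝ) (φ := fun _ : Fin (ℓ + 1) => E) a).hasFDerivWithinAt
    refine h'.congr_of_eventuallyEq ?_ ?_
    · filter_upwards [extChartAt_target_mem_nhdsWithin (I := powModel I ℓ) x] with y hy
      exact (extChartAt I (x a)).right_inv ⟨hy.1 a trivial, hy.2 a trivial⟩
    · exact (extChartAt I (x a)).right_inv
        ((extChartAt I (x a)).map_source (mem_extChartAt_source (x a)))
  rw [h.mfderiv]
  rfl

/-- The linear map `ℝ^k → ℝ^{k(ℓ+1)}` with `e_β ↦ e_{ak+β}`, for `a = 0, …, ℓ`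
(`finProdFinEquiv (a, β)` is the index `β + k * a`). -/
def blockInclusion (ℓ k : ℕ) (a : Fin (ℓ + 1)) : (Fin k → ℝ) →L[ℝ] (Fin ((ℓ + 1) * k) → ℝ) :=
  ∑ β : Fin k, (ContinuousLinearMap.proj (R := ℝ) (φ := fun _ : Fin k => ℝ) β).smulRight
    (Pi.single (finProdFinEquiv (a, β)) 1)

/-- The form `∑_a pr_a^* η = ∑_a ∑_β (pr_a^* η_β) ⊗ e_{ak+β}` on `N^{ℓ+1}`, where
`pr_a : N^{ℓ+1} → N` is the projection to the `a`-th factor. -/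
def prolongedForm (ℓ : ℕ) {k : ℕ} (η : ∀ x : N, TangentSpace I x →L[ℝ] (Fin k → ℝ))
    (x : Fin (ℓ + 1) → N) :
    TangentSpace (powModel I ℓ) x →L[ℝ] (Fin ((ℓ + 1) * k) → ℝ) :=
  ∑ a : Fin (ℓ + 1), (blockInclusion ℓ k a).comp
    ((η (x a)).comp (mfderiv (powModel I ℓ) I (fun y : Fin (ℓ + 1) → N => y a) x))

/-- The function `∑_a pr_a^* h = ∑_a ∑_β (pr_a^* h_β) e_{ak+β}` on `N^{ℓ+1}`. -/
def prolongedFunction (ℓ : ℕ) {k : ℕ} (h : N → Fin k → ℝ) (x : Fin (ℓ + 1) → N) :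
    Fin ((ℓ + 1) * k) → ℝ :=
  ∑ a : Fin (ℓ + 1), blockInclusion ℓ k a (h (x a))

end Prolongation

end KContact

end

noncomputable section

namespace KContact

section PowManifold

variable {E : Type*} [NormedAddCommGroup E] [NormedSpace ℝ E] {H : Type*} [TopologicalSpace H]
  {I : ModelWithCorners ℝ E H} {N : Type*} [TopologicalSpace N] [ChartedSpace H N] {ℓ : ℕ}

instance boundaryless_powModel [I.Boundaryless] : (powModel I ℓ).Boundaryless := by
  refine ⟨Set.eq_univ_of_forall fun y => ?_⟩
  have h : ∀ a, ∃ z : H, I z = y a := fun a => by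
    have : y a ∈ Set.range I := by rw [I.range_eq_univ]; trivial
    exact this
  choose z hz using h
  exact ⟨z, funext hz⟩

theorem extChartAt_pow_symm_apply (x : Fin (ℓ + 1) → N) (y : Fin (ℓ + 1) → E)
    (a : Fin (ℓ + 1)) :
    (extChartAt (powModel I ℓ) x).symm y a = (extChartAt I (x a)).symm (y a) := rfl

theorem mem_extChartAt_pow_target {x : Fin (ℓ + 1) → N} {y : Fin (ℓ + 1) → E}
    (hy : y ∈ (extChartAt (powModel I ℓ) x).target) (a : Fin (ℓ + 1)) :
    y a ∈ (extChartAt I (x a)).target :=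
  ⟨hy.1 a trivial, hy.2 a trivial⟩

theorem mem_chartAt_pow_source {x p : Fin (ℓ + 1) → N}
    (hp : p ∈ (chartAt (ModelPi fun _ : Fin (ℓ + 1) => H) x).source) (a : Fin (ℓ + 1)) :
    p a ∈ (chartAt H (x a)).source :=
  hp a trivial

theorem hasMFDerivAt_proj (a : Fin (ℓ + 1)) (x : Fin (ℓ + 1) → N) :
    HasMFDerivAt (powModel I ℓ) I (fun y : Fin (ℓ + 1) → N => y a) x
      (ContinuousLinearMap.proj (R := ℝ) (φ := fun _ : Fin (ℓ + 1) => E) a) := by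
  refine ⟨(continuous_apply a).continuousAt, ?_⟩
  have h' : HasFDerivWithinAt (fun y : Fin (ℓ + 1) → E => y a)
      (ContinuousLinearMap.proj (R := ℝ) (φ := fun _ : Fin (ℓ + 1) => E) a)
      (Set.range (powModel I ℓ)) (extChartAt (powModel I ℓ) x x) :=
    (ContinuousLinearMap.proj (R := ℝ) (φ := fun _ : Fin (ℓ + 1) => E) a).hasFDerivWithinAt
  refine h'.congr_of_eventuallyEq ?_ ?_
  · filter_upwards [extChartAt_target_mem_nhdsWithin (I := powModel I ℓ) x] with y hy
    exact (extChartAt I (x a)).right_inv (mem_extChartAt_pow_target hy a)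
  · exact (extChartAt I (x a)).right_inv (mem_extChartAt_target (x a))

theorem mfderiv_proj_apply (a : Fin (ℓ + 1)) (x : Fin (ℓ + 1) → N) (v : Fin (ℓ + 1) → E) :
    (mfderiv (powModel I ℓ) I (fun y : Fin (ℓ + 1) → N => y a) x v : E) = v a := by
  rw [(hasMFDerivAt_proj a x).mfderiv]
  rfl

theorem contMDiffAt_pow {E' : Type*} [NormedAddCommGroup E'] [NormedSpace ℝ E'] {H' : Type*}
    [TopologicalSpace H'] {I' : ModelWithCorners ℝ E' H'} {M : Type*} [TopologicalSpace M]
    [ChartedSpace H' M] {n : WithTop ℕ∞} {f : M → Fin (ℓ + 1) → N} {m : M} :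
    ContMDiffAt I' (powModel I ℓ) n f m ↔ ∀ a, ContMDiffAt I' I n (fun q => f q a) m := by
  simp only [contMDiffAt_iff, continuousAt_pi, forall_and]
  exact and_congr_right fun _ => contDiffWithinAt_pi

theorem contMDiff_proj {n : WithTop ℕ∞} (a : Fin (ℓ + 1)) :
    ContMDiff (powModel I ℓ) I n (fun y : Fin (ℓ + 1) → N => y a) := fun _ =>
  contMDiffAt_pow.1 contMDiffAt_id a

theorem contMDiff_update {n : WithTop ℕ∞} (x : Fin (ℓ + 1) → N) (a : Fin (ℓ + 1)) :
    ContMDiff I (powModel I ℓ) n (fun p : N => Function.update x a p) := fun p => by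
  refine contMDiffAt_pow.2 fun b => ?_
  rcases eq_or_ne b a with rfl | h
  · simpa using! contMDiffAt_id
  · simpa [Function.update_of_ne h] using contMDiffAt_const

theorem mfderiv_extChartAt_pow [IsManifold I 1 N] {x p : Fin (ℓ + 1) → N}
    (hp : p ∈ (chartAt (ModelPi fun _ : Fin (ℓ + 1) => H) x).source) (v : Fin (ℓ + 1) → E)
    (a : Fin (ℓ + 1)) :
    (mfderiv (powModel I ℓ) 𝓘(ℝ, Fin (ℓ + 1) → E) (extChartAt (powModel I ℓ) x) p v :
      Fin (ℓ + 1) → E) a = mfderiv I 𝓘(ℝ, E) (extChartAt I (x a)) (p a) (v a) := by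
  have h1 : HasMFDerivAt (powModel I ℓ) 𝓘(ℝ, E) (fun q => extChartAt I (x a) (q a)) p
      ((mfderiv I 𝓘(ℝ, E) (extChartAt I (x a)) (p a)).comp
        (ContinuousLinearMap.proj (R := ℝ) (φ := fun _ : Fin (ℓ + 1) => E) a)) :=
    HasMFDerivAt.comp (I' := I) p
      (mdifferentiableAt_extChartAt (mem_chartAt_pow_source hp a)).hasMFDerivAt
      (hasMFDerivAt_proj a p)
  have h2 : HasMFDerivAt (powModel I ℓ) 𝓘(ℝ, E)
      (fun q => extChartAt (powModel I ℓ) x q a) p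
      ((ContinuousLinearMap.proj (R := ℝ) (φ := fun _ : Fin (ℓ + 1) => E) a).comp
        (mfderiv (powModel I ℓ) 𝓘(ℝ, Fin (ℓ + 1) → E) (extChartAt (powModel I ℓ) x) p)) :=
    HasMFDerivAt.comp (I' := 𝓘(ℝ, Fin (ℓ + 1) → E)) (f := extChartAt (powModel I ℓ) x)
      (g := ContinuousLinearMap.proj (R := ℝ) (φ := fun _ : Fin (ℓ + 1) => E) a) p
      (ContinuousLinearMap.proj (R := ℝ) (φ := fun _ : Fin (ℓ + 1) => E) a).hasMFDerivAt
      (mdifferentiableAt_extChartAt hp).hasMFDerivAt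
  exact DFunLike.congr_fun (hasMFDerivAt_unique h2 h1) v

theorem mfderivWithin_extChartAt_pow_symm [IsManifold I 1 N] {x : Fin (ℓ + 1) → N}
    {y : Fin (ℓ + 1) → E} (hy : y ∈ (extChartAt (powModel I ℓ) x).target)
    (v : Fin (ℓ + 1) → E) (a : Fin (ℓ + 1)) :
    (mfderivWithin 𝓘(ℝ, Fin (ℓ + 1) → E) (powModel I ℓ) (extChartAt (powModel I ℓ) x).symm
      (Set.range (powModel I ℓ)) y v : Fin (ℓ + 1) → E) a =
      mfderivWithin 𝓘(ℝ, E) I (extChartAt I (x a)).symm (Set.range I) (y a) (v a) := by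
  have h1 : HasMFDerivWithinAt 𝓘(ℝ, Fin (ℓ + 1) → E) I
      (fun z : Fin (ℓ + 1) → E => (extChartAt I (x a)).symm (z a)) (Set.range (powModel I ℓ)) y
      ((mfderivWithin 𝓘(ℝ, E) I (extChartAt I (x a)).symm (Set.range I) (y a)).comp
        (ContinuousLinearMap.proj (R := ℝ) (φ := fun _ : Fin (ℓ + 1) => E) a)) := by
    refine HasMFDerivWithinAt.comp (I' := 𝓘(ℝ, E)) (u := Set.range I) y
      (mdifferentiableWithinAt_extChartAt_symm
        (mem_extChartAt_pow_target hy a)).hasMFDerivWithinAt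
      (ContinuousLinearMap.proj (R := ℝ)
        (φ := fun _ : Fin (ℓ + 1) => E) a).hasMFDerivAt.hasMFDerivWithinAt ?_
    rintro _ ⟨z, rfl⟩
    exact ⟨z a, rfl⟩
  have h2 : HasMFDerivWithinAt 𝓘(ℝ, Fin (ℓ + 1) → E) I
      (fun z => (extChartAt (powModel I ℓ) x).symm z a) (Set.range (powModel I ℓ)) y
      ((ContinuousLinearMap.proj (R := ℝ) (φ := fun _ : Fin (ℓ + 1) => E) a).comp
        (mfderivWithin 𝓘(ℝ, Fin (ℓ + 1) → E) (powModel I ℓ) (extChartAt (powModel I ℓ) x).symm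
          (Set.range (powModel I ℓ)) y)) :=
    HasMFDerivAt.comp_hasMFDerivWithinAt (I' := powModel I ℓ)
      (f := (extChartAt (powModel I ℓ) x).symm) (g := fun p : Fin (ℓ + 1) → N => p a) y
      (hasMFDerivAt_proj a _)
      (mdifferentiableWithinAt_extChartAt_symm hy).hasMFDerivWithinAt
  have hU : UniqueMDiffWithinAt 𝓘(ℝ, Fin (ℓ + 1) → E) (Set.range (powModel I ℓ)) y :=
    (powModel I ℓ).uniqueMDiffOn y (extChartAt_target_subset_range x hy)
  exact DFunLike.congr_fun (hU.eq h2 h1) v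

theorem tangentBundle_mk_congr {p q : N} (h : p = q) (v : E) :
    (⟨p, v⟩ : TangentBundle I N) = ⟨q, v⟩ := by
  subst h
  rfl

theorem trivializationAt_tangent_apply_snd [IsManifold I 1 N] {x p : N}
    (hp : p ∈ (chartAt H x).source) (v : TangentSpace I p) :
    (trivializationAt E (TangentSpace I) x (⟨p, v⟩ : TangentBundle I N)).2 =
      mfderiv I 𝓘(ℝ, E) (extChartAt I x) p v := by
  rw [← TangentBundle.continuousLinearMapAt_trivializationAt hp]
  symm
  apply Bundle.Trivialization.continuousLinearMapAt_apply_of_mem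
  exact hp

/-- A map into `T(N^{ℓ+1})` is smooth as soon as its components in `TN` are. -/
theorem contMDiff_tangentBundle_pow {E' : Type*} [NormedAddCommGroup E'] [NormedSpace ℝ E']
    {H' : Type*} [TopologicalSpace H'] {I' : ModelWithCorners ℝ E' H'} {M : Type*}
    [TopologicalSpace M] [ChartedSpace H' M] [IsManifold I ∞ N]
    {f : M → Fin (ℓ + 1) → N} {V : M → Fin (ℓ + 1) → E}
    (h : ∀ a, ContMDiff I' I.tangent ∞ (fun m => (⟨f m a, V m a⟩ : TangentBundle I N))) :
    ContMDiff I' (powModel I ℓ).tangent ∞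
      (fun m => (⟨f m, V m⟩ : TangentBundle (powModel I ℓ) (Fin (ℓ + 1) → N))) := by
  have : IsManifold I 1 N := inferInstance
  intro m
  have h' := fun a => (Bundle.contMDiffAt_totalSpace.1 (h a m))
  have hf : ContMDiffAt I' (powModel I ℓ) ∞ f m := contMDiffAt_pow.2 fun a => (h' a).1
  refine Bundle.contMDiffAt_totalSpace.2 ⟨hf, contMDiffAt_pi_space.2 fun a => ?_⟩
  refine (h' a).2.congr_of_eventuallyEq ?_
  filter_upwards [hf.continuousAt.preimage_mem_nhds
    (chart_source_mem_nhds (ModelPi fun _ : Fin (ℓ + 1) => H) (f m))] with q hq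
  have e1 := trivializationAt_tangent_apply_snd (I := powModel I ℓ) (x := f m) (p := f q) hq (V q)
  have e2 := trivializationAt_tangent_apply_snd (I := I) (mem_chartAt_pow_source hq a) (V q a)
  exact (congrFun e1 a).trans ((mfderiv_extChartAt_pow hq (V q) a).trans e2.symm)

theorem IsSmoothVectorField.diagonalProlongation [IsManifold I ∞ N]
    {Y : ∀ x : N, TangentSpace I x} (hY : IsSmoothVectorField I Y) :
    IsSmoothVectorField (powModel I ℓ) (diagonalProlongation I ℓ Y) :=
  contMDiff_tangentBundle_pow (f := id) fun a => hY.comp (contMDiff_proj a)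

/-- The `a`-th component of a vector field on `N^{ℓ+1}`, restricted to the slice through `x` in the
direction of the `a`-th factor. -/
def sliceField (Z : ∀ x : Fin (ℓ + 1) → N, TangentSpace (powModel I ℓ) x) (x : Fin (ℓ + 1) → N)
    (a : Fin (ℓ + 1)) (p : N) : TangentSpace I p :=
  (Z (Function.update x a p) : Fin (ℓ + 1) → E) a

theorem sliceField_self (Z : ∀ x : Fin (ℓ + 1) → N, TangentSpace (powModel I ℓ) x)
    (x : Fin (ℓ + 1) → N) (a : Fin (ℓ + 1)) :
    (sliceField Z x a (x a) : E) = (Z x : Fin (ℓ + 1) → E) a := by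
  have h : ∀ q, q = x → (Z q : Fin (ℓ + 1) → E) a = (Z x : Fin (ℓ + 1) → E) a := by
    rintro q rfl
    rfl
  exact h _ (Function.update_eq_self a x)

theorem IsSmoothVectorField.sliceField [IsManifold I ∞ N]
    {Z : ∀ x : Fin (ℓ + 1) → N, TangentSpace (powModel I ℓ) x}
    (hZ : IsSmoothVectorField (powModel I ℓ) Z) (x : Fin (ℓ + 1) → N) (a : Fin (ℓ + 1)) :
    IsSmoothVectorField I (sliceField Z x a) := by
  have h1 : ContMDiff (powModel I ℓ).tangent I.tangent ∞
      (tangentMap (powModel I ℓ) I (fun y : Fin (ℓ + 1) → N => y a)) :=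
    (contMDiff_proj (n := ∞) a).contMDiff_tangentMap (by simp)
  refine (h1.comp (hZ.comp (contMDiff_update x a))).congr fun p => ?_
  have h2 := mfderiv_proj_apply (I := I) a (Function.update x a p) (Z (Function.update x a p))
  exact (tangentBundle_mk_congr (Function.update_self a p x).symm _).trans
    (congrArg (Bundle.TotalSpace.mk (F := E) (E := TangentSpace I) (Function.update x a p a))
      h2.symm)

end PowManifold

section LocalField

variable {E : Type*} [NormedAddCommGroup E] [NormedSpace ℝ E] {H : Type*} [TopologicalSpace H]
  (I : ModelWithCorners ℝ E H) {M : Type*} [TopologicalSpace M] [ChartedSpace H M]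

/-- The local expression of a vector field in the preferred chart at `x`. -/
def localField (V : ∀ x : M, TangentSpace I x) (x : M) (y : E) : E :=
  mfderiv I 𝓘(ℝ, E) (extChartAt I x) ((extChartAt I x).symm y) (V ((extChartAt I x).symm y))

variable {I}

theorem localField_self [IsManifold I 1 M] (V : ∀ x : M, TangentSpace I x) (x : M) :
    localField I V x (extChartAt I x x) = V x := by
  have h : ∀ p, p = x → (mfderiv I 𝓘(ℝ, E) (extChartAt I x) p (V p) : E) = V x := by
    rintro p rfl
    rw [mfderiv_extChartAt_self]
    rfl
  exact h _ (extChartAt_to_inv x)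

theorem mpullbackWithin_extChartAt_symm_eq_localField [IsManifold I 1 M]
    (V : ∀ x : M, TangentSpace I x) (x : M) {y : E} (hy : y ∈ (extChartAt I x).target) :
    VectorField.mpullbackWithin 𝓘(ℝ, E) I (extChartAt I x).symm V (Set.range I) y =
      localField I V x y := by
  rw [VectorField.mpullbackWithin_apply,
    ContinuousLinearMap.inverse_eq (mfderivWithin_extChartAt_symm_comp_mfderiv_extChartAt hy)
      (mfderiv_extChartAt_comp_mfderivWithin_extChartAt_symm hy)]
  rfl

variable [I.Boundaryless]

theorem eventuallyEq_localField [IsManifold I 1 M] (V : ∀ x : M, TangentSpace I x) (x : M) :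
    VectorField.mpullbackWithin 𝓘(ℝ, E) I (extChartAt I x).symm V (Set.range I)
      =ᶠ[𝓝 (extChartAt I x x)] localField I V x := by
  filter_upwards [extChartAt_target_mem_nhds (I := I) x] with y hy
  exact mpullbackWithin_extChartAt_symm_eq_localField V x hy

theorem IsSmoothVectorField.differentiableAt_localField [IsManifold I ∞ M] [CompleteSpace E]
    {V : ∀ x : M, TangentSpace I x} (hV : IsSmoothVectorField I V) (x : M) :
    DifferentiableAt ℝ (localField I V x) (extChartAt I x x) := by
  have : IsManifold I 2 M := inferInstance
  have : IsManifold I 1 M := inferInstance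
  have h : MDifferentiableAt I I.tangent (fun x => (⟨x, V x⟩ : TangentBundle I M)) x :=
    (hV x).mdifferentiableAt (by simp)
  have h1 : DifferentiableWithinAt ℝ
      (VectorField.mpullbackWithin 𝓘(ℝ, E) I (extChartAt I x).symm V (Set.range I) : E → E)
      ((extChartAt I x).symm ⁻¹' Set.univ ∩ Set.range I) (extChartAt I x x) :=
    (mdifferentiableWithinAt_univ.2 h).differentiableWithinAt_mpullbackWithin_vectorField
  refine (h1.differentiableAt ?_).congr_of_eventuallyEq (eventuallyEq_localField V x).symm
  simp [I.range_eq_univ]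

theorem mlieBracket_eq_lieBracket_localField [IsManifold I 1 M]
    (V W : ∀ x : M, TangentSpace I x) (x : M) :
    VectorField.mlieBracket I V W x =
      VectorField.lieBracket ℝ (localField I V x) (localField I W x) (extChartAt I x x) := by
  have h := Filter.EventuallyEq.lieBracket_vectorField_eq (𝕜 := ℝ) (eventuallyEq_localField V x)
    (eventuallyEq_localField W x)
  have hs : (extChartAt I x).symm ⁻¹' Set.univ ∩ Set.range I = Set.univ := by
    simp [I.range_eq_univ]
  have hid : ∀ v : E, (mfderiv I 𝓘(ℝ, E) (extChartAt I x) x).inverse v = v := fun v => by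
    rw [mfderiv_extChartAt_self]
    exact DFunLike.congr_fun (ContinuousLinearMap.inverse_id (R := ℝ) (M := E)) v
  rw [← VectorField.mlieBracketWithin_univ, VectorField.mlieBracketWithin_apply]
  refine (hid _).trans ?_
  rw [hs]
  exact (congrFun (VectorField.lieBracketWithin_univ (𝕜 := ℝ) (E := E)) _).trans h

end LocalField

section Bracket

variable {E : Type*} [NormedAddCommGroup E] [NormedSpace ℝ E] {H : Type*} [TopologicalSpace H]
  {I : ModelWithCorners ℝ E H} {N : Type*} [TopologicalSpace N] [ChartedSpace H N] {ℓ : ℕ}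

theorem localField_pow_apply [IsManifold I 1 N]
    (Z : ∀ x : Fin (ℓ + 1) → N, TangentSpace (powModel I ℓ) x) {x : Fin (ℓ + 1) → N}
    {y : Fin (ℓ + 1) → E} (hy : y ∈ (extChartAt (powModel I ℓ) x).target) (a : Fin (ℓ + 1)) :
    localField (powModel I ℓ) Z x y a =
      mfderiv I 𝓘(ℝ, E) (extChartAt I (x a)) ((extChartAt I (x a)).symm (y a))
        ((Z ((extChartAt (powModel I ℓ) x).symm y) : Fin (ℓ + 1) → E) a) := by
  have h := (extChartAt (powModel I ℓ) x).map_target hy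
  rw [extChartAt_source] at h
  exact mfderiv_extChartAt_pow h _ a

variable [I.Boundaryless]

theorem fderiv_localField_diagonalProlongation [IsManifold I ∞ N] [CompleteSpace E]
    {Y : ∀ x : N, TangentSpace I x} (hY : IsSmoothVectorField I Y) (x : Fin (ℓ + 1) → N)
    (v : Fin (ℓ + 1) → E) (a : Fin (ℓ + 1)) :
    fderiv ℝ (localField (powModel I ℓ) (diagonalProlongation I ℓ Y) x)
      (extChartAt (powModel I ℓ) x x) v a =
      fderiv ℝ (localField I Y (x a)) (extChartAt I (x a) (x a)) (v a) := by
  have : IsManifold I 1 N := inferInstance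
  have h : HasFDerivAt (localField (powModel I ℓ) (diagonalProlongation I ℓ Y) x)
      (ContinuousLinearMap.pi fun b => (fderiv ℝ (localField I Y (x b))
        (extChartAt I (x b) (x b))).comp
          (ContinuousLinearMap.proj (R := ℝ) (φ := fun _ : Fin (ℓ + 1) => E) b))
      (extChartAt (powModel I ℓ) x x) := by
    rw [hasFDerivAt_pi']
    intro b
    have h1 := (hY.differentiableAt_localField (x b)).hasFDerivAt
    have h2 : HasFDerivAt (fun y : Fin (ℓ + 1) → E => localField I Y (x b) (y b)) _
      (extChartAt (powModel I ℓ) x x) := HasFDerivAt.comp (extChartAt (powModel I ℓ) x x)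
        (f := fun y : Fin (ℓ + 1) → E => y b) h1
        (ContinuousLinearMap.proj (R := ℝ) (φ := fun _ : Fin (ℓ + 1) => E) b).hasFDerivAt
    refine h2.congr_of_eventuallyEq ?_
    filter_upwards [extChartAt_target_mem_nhds (I := powModel I ℓ) x] with y hy
    exact localField_pow_apply _ hy b
  rw [h.fderiv]
  rfl

theorem mlieBracket_diagonalProlongation [IsManifold I ∞ N] [CompleteSpace E]
    {Y Z : ∀ x : N, TangentSpace I x} (hY : IsSmoothVectorField I Y)
    (hZ : IsSmoothVectorField I Z) :
    VectorField.mlieBracket (powModel I ℓ) (diagonalProlongation I ℓ Y)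
      (diagonalProlongation I ℓ Z) =
      diagonalProlongation I ℓ (VectorField.mlieBracket I Y Z) := by
  have : IsManifold I 1 N := inferInstance
  funext x
  rw [mlieBracket_eq_lieBracket_localField]
  funext a
  have h := mlieBracket_eq_lieBracket_localField Y Z (x a)
  refine Eq.trans ?_ h.symm
  simp only [VectorField.lieBracket_eq]
  rw [localField_self, localField_self, localField_self, localField_self]
  exact congrArg₂ (· - ·) (fderiv_localField_diagonalProlongation hZ x _ a)
    (fderiv_localField_diagonalProlongation hY x _ a)

/-- The `a`-th component of `[Y^{[ℓ+1]}, Z]` differs from the bracket of `Y` with the slice of `Z` by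
a derivative of `Z` transversal to the slice. -/
theorem mlieBracket_diagonalProlongation_apply [IsManifold I ∞ N] [CompleteSpace E]
    {Y : ∀ x : N, TangentSpace I x} (hY : IsSmoothVectorField I Y)
    {Z : ∀ x : Fin (ℓ + 1) → N, TangentSpace (powModel I ℓ) x}
    (hZ : IsSmoothVectorField (powModel I ℓ) Z) (x : Fin (ℓ + 1) → N) (a : Fin (ℓ + 1)) :
    (VectorField.mlieBracket (powModel I ℓ) (diagonalProlongation I ℓ Y) Z x :
      Fin (ℓ + 1) → E) a =
      (show E from VectorField.mlieBracket I Y (sliceField Z x a) (x a)) +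
      fderiv ℝ (localField (powModel I ℓ) Z x) (extChartAt (powModel I ℓ) x x)
        (Function.update (diagonalProlongation I ℓ Y x : Fin (ℓ + 1) → E) a 0) a := by
  have : IsManifold I 1 N := inferInstance
  set W : ∀ p : N, TangentSpace I p := sliceField Z x a
  set y₀ := extChartAt (powModel I ℓ) x x
  have hloc : localField I W (x a) =ᶠ[𝓝 (y₀ a)]
      fun z => localField (powModel I ℓ) Z x (Function.update y₀ a z) a := by
    have hc : ContinuousAt (fun z => Function.update y₀ a z) (y₀ a) :=
      (continuous_const.update a continuous_id).continuousAt
    have ht : (extChartAt (powModel I ℓ) x).target ∈ 𝓝 (Function.update y₀ a (y₀ a)) := by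
      rw [Function.update_eq_self]
      exact extChartAt_target_mem_nhds x
    filter_upwards [hc ht] with z hz
    have hs : (extChartAt (powModel I ℓ) x).symm (Function.update y₀ a z) =
        Function.update x a ((extChartAt I (x a)).symm z) := by
      funext b
      rw [extChartAt_pow_symm_apply]
      rcases eq_or_ne b a with rfl | h
      · simp
      · rw [Function.update_of_ne h, Function.update_of_ne h]
        exact extChartAt_to_inv (x b)
    have h : ∀ q, q = Function.update x a ((extChartAt I (x a)).symm z) → ∀ w, w = z →
        (mfderiv I 𝓘(ℝ, E) (extChartAt I (x a)) ((extChartAt I (x a)).symm w)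
          ((Z q : Fin (ℓ + 1) → E) a) : E) = localField I W (x a) z := by
      rintro q rfl w rfl
      rfl
    exact ((localField_pow_apply Z hz a).trans (h _ hs _ (Function.update_self a z y₀))).symm
  have hder : HasFDerivAt (localField I W (x a))
      (((ContinuousLinearMap.proj (R := ℝ) (φ := fun _ : Fin (ℓ + 1) => E) a).comp
        (fderiv ℝ (localField (powModel I ℓ) Z x) y₀)).comp
          (.pi (Pi.single a (.id ℝ E)))) (y₀ a) := by
    have h1 : HasFDerivAt (fun z => Function.update y₀ a z)
        (.pi (Pi.single a (.id ℝ E))) (y₀ a) :=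
      hasFDerivAt_update y₀ (y₀ a)
    have h2 : HasFDerivAt (localField (powModel I ℓ) Z x)
        (fderiv ℝ (localField (powModel I ℓ) Z x) y₀) (Function.update y₀ a (y₀ a)) := by
      rw [Function.update_eq_self]
      exact (hZ.differentiableAt_localField x).hasFDerivAt
    have h3 := ((ContinuousLinearMap.proj (R := ℝ)
      (φ := fun _ : Fin (ℓ + 1) => E) a).hasFDerivAt.comp _ h2).comp (y₀ a) h1
    exact h3.congr_of_eventuallyEq hloc
  have hsplit : ∀ v : Fin (ℓ + 1) → E, v = Pi.single a (v a) + Function.update v a 0 := by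
    intro v
    funext b
    rcases eq_or_ne b a with rfl | h
    · simp
    · simp [h]
  have hW_der : ∀ v : E, fderiv ℝ (localField I W (x a)) (extChartAt I (x a) (x a)) v =
      fderiv ℝ (localField (powModel I ℓ) Z x) y₀ (Pi.single a v) a := by
    intro v
    have h1 : (ContinuousLinearMap.pi (Pi.single a (ContinuousLinearMap.id ℝ E)) :
        E →L[ℝ] Fin (ℓ + 1) → E) v = Pi.single a v := by
      funext b
      rcases eq_or_ne b a with rfl | h
      · simp
      · simp [h]
    rw [← h1]
    exact DFunLike.congr_fun hder.fderiv v
  have hZ_der : ∀ v : Fin (ℓ + 1) → E, fderiv ℝ (localField (powModel I ℓ) Z x) y₀ v a =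
      fderiv ℝ (localField I W (x a)) (extChartAt I (x a) (x a)) (v a) +
      fderiv ℝ (localField (powModel I ℓ) Z x) y₀ (Function.update v a 0) a := by
    intro v
    conv_lhs => rw [hsplit v, map_add]
    rw [hW_der]
    rfl
  have e1 := mlieBracket_eq_lieBracket_localField (diagonalProlongation I ℓ Y) Z x
  have e2 := mlieBracket_eq_lieBracket_localField Y W (x a)
  refine (congrFun e1 a).trans (Eq.trans ?_ (congrArg (· + _) e2.symm))
  simp only [VectorField.lieBracket_eq]
  rw [localField_self, localField_self, localField_self, localField_self]
  refine (congrArg₂ (· - ·) (hZ_der _)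
    (fderiv_localField_diagonalProlongation hY x (Z x) a)).trans ?_
  have e3 : fderiv ℝ (localField I Y (x a)) (extChartAt I (x a) (x a)) (W (x a)) =
      fderiv ℝ (localField I Y (x a)) (extChartAt I (x a) (x a))
        ((Z x : Fin (ℓ + 1) → E) a) := congrArg _ (sliceField_self Z x a)
  rw [e3]
  exact add_sub_right_comm _ _ _

end Bracket

section Block

theorem sum_blockInclusion_apply {ℓ k : ℕ} (f : Fin (ℓ + 1) → Fin k → ℝ) (a : Fin (ℓ + 1))
    (β : Fin k) : (∑ b, blockInclusion ℓ k b (f b)) (finProdFinEquiv (a, β)) = f a β := by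
  simp only [blockInclusion, sum_apply, ContinuousLinearMap.smulRight_apply,
    ContinuousLinearMap.proj_apply, Finset.sum_apply, Pi.smul_apply, Pi.single_apply,
    EmbeddingLike.apply_eq_iff_eq, Prod.mk.injEq, smul_eq_mul, mul_ite, mul_one, mul_zero]
  rw [Finset.sum_eq_single a, Finset.sum_eq_single β] <;> simp +contextual [eq_comm]

theorem sum_blockInclusion_eq_zero_iff {ℓ k : ℕ} {f : Fin (ℓ + 1) → Fin k → ℝ} :
    ∑ b, blockInclusion ℓ k b (f b) = 0 ↔ ∀ a, f a = 0 := by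
  refine ⟨fun h a => ?_, fun h => by simp [h]⟩
  funext β
  rw [← sum_blockInclusion_apply f a β, h]
  rfl

end Block

section LocalForm

variable {E : Type*} [NormedAddCommGroup E] [NormedSpace ℝ E] {H : Type*} [TopologicalSpace H]
  {I : ModelWithCorners ℝ E H} {M : Type*} [TopologicalSpace M] [ChartedSpace H M]
  {F : Type*} [NormedAddCommGroup F] [NormedSpace ℝ F]

theorem isSmoothOneForm_iff_localForm [IsManifold I ∞ M]
    {η : ∀ x : M, TangentSpace I x →L[ℝ] F} :
    IsSmoothOneForm I η ↔ ∀ x : M,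
      ContMDiffAt I 𝓘(ℝ, E →L[ℝ] F) ∞ (fun p => localForm I η x (extChartAt I x p)) x := by
  have : IsManifold I 1 M := inferInstance
  refine forall_congr' fun x => ?_
  rw [contMDiffAt_hom_bundle]
  refine (and_iff_right contMDiffAt_id).trans (Filter.EventuallyEq.contMDiffAt_iff ?_)
  filter_upwards [chart_source_mem_nhds H x] with p hp
  have hs := TangentBundle.symmL_trivializationAt (I := I) (𝕜 := ℝ) hp
  have hq : ∀ q, q = p → ∀ v : E, η p ((mfderivWithin 𝓘(ℝ, E) I (extChartAt I x).symm
      (Set.range I) (extChartAt I x p)) v) = η q ((mfderivWithin 𝓘(ℝ, E) I (extChartAt I x).symm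
      (Set.range I) (extChartAt I x p)) v) := by
    rintro q rfl v
    rfl
  ext v
  refine Eq.trans ?_ (hq _ ((extChartAt I x).left_inv (by rwa [extChartAt_source])) v)
  rw [← hs]
  exact DFunLike.congr_fun (Bundle.Trivial.continuousLinearMapAt_trivialization ℝ M F p) _

theorem IsSmoothOneForm.differentiableAt_localForm [I.Boundaryless] [IsManifold I ∞ M]
    {η : ∀ x : M, TangentSpace I x →L[ℝ] F} (hη : IsSmoothOneForm I η) (x : M) :
    DifferentiableAt ℝ (localForm I η x) (extChartAt I x x) := by
  have h := (isSmoothOneForm_iff_localForm.1 hη x)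
  have h1 : ContMDiffAt 𝓘(ℝ, E) I ∞ (extChartAt I x).symm (extChartAt I x x) :=
    (contMDiffOn_extChartAt_symm x).contMDiffAt (extChartAt_target_mem_nhds x)
  have h2 : ContMDiffAt 𝓘(ℝ, E) 𝓘(ℝ, E →L[ℝ] F) ∞ (fun y => localForm I η x
      (extChartAt I x ((extChartAt I x).symm y))) (extChartAt I x x) :=
    ContMDiffAt.comp_of_eq h h1 (extChartAt_to_inv x)
  refine (h2.contDiffAt.differentiableAt (by simp)).congr_of_eventuallyEq ?_
  filter_upwards [extChartAt_target_mem_nhds (I := I) x] with y hy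
  rw [(extChartAt I x).right_inv hy]

theorem extDerivOneForm_apply [I.Boundaryless] [IsManifold I ∞ M]
    {η : ∀ x : M, TangentSpace I x →L[ℝ] F} (hη : IsSmoothOneForm I η) (x : M) (v w : E) :
    extDerivOneForm I η x ![v, w] =
      fderiv ℝ (localForm I η x) (extChartAt I x x) v w -
        fderiv ℝ (localForm I η x) (extChartAt I x x) w v := by
  have : IsManifold I 1 M := inferInstance
  have hd := hη.differentiableAt_localForm x
  have hω : DifferentiableAt ℝ (fun y : E =>
      ContinuousAlternatingMap.ofSubsingleton ℝ E F (0 : Fin 1) (localForm I η x y))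
      (extChartAt I x x) :=
    (ContinuousAlternatingMap.ofSubsingletonLIE (𝕜 := ℝ) (E := E) (F := F)
      (0 : Fin 1)).toContinuousLinearEquiv.differentiableAt.comp _ hd
  have h1 : ∀ u : E, fderiv ℝ (fun y => localForm I η x y u) (extChartAt I x x) =
      (fderiv ℝ (localForm I η x) (extChartAt I x x)).flip u := fun u => by
    rw [fderiv_clm_apply hd (differentiableAt_const u)]
    simp
  have h2 : extDerivOneForm I η x ![v, w] = extDeriv (fun y : E =>
      ContinuousAlternatingMap.ofSubsingleton ℝ E F (0 : Fin 1) (localForm I η x y))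
      (extChartAt I x x) ![v, w] := by
    rw [extDerivOneForm, I.range_eq_univ, extDerivWithin_univ, mfderiv_extChartAt_self]
    rfl
  rw [h2, extDeriv_apply hω]
  generalize extChartAt I x x = y₀ at h1
  simp [Fin.sum_univ_two, h1, Fin.removeNth, sub_eq_add_neg]

end LocalForm

section ProlongedForm

variable {E : Type*} [NormedAddCommGroup E] [NormedSpace ℝ E] {H : Type*} [TopologicalSpace H]
  {I : ModelWithCorners ℝ E H} {N : Type*} [TopologicalSpace N] [ChartedSpace H N] {ℓ k : ℕ}
  {η : ∀ x : N, TangentSpace I x →L[ℝ] (Fin k → ℝ)}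

theorem prolongedForm_apply (x : Fin (ℓ + 1) → N) (v : Fin (ℓ + 1) → E) :
    prolongedForm I ℓ η x v = ∑ a, blockInclusion ℓ k a (η (x a) (v a)) := by
  refine (sum_apply Finset.univ _ _).trans (Finset.sum_congr rfl fun a _ => ?_)
  exact congrArg (fun u : E => blockInclusion ℓ k a (η (x a) u)) (mfderiv_proj_apply a x v)

theorem prolongedForm_apply_eq_zero_iff {x : Fin (ℓ + 1) → N} {v : Fin (ℓ + 1) → E} :
    prolongedForm I ℓ η x v = 0 ↔ ∀ a, η (x a) (v a) = 0 := by
  rw [prolongedForm_apply, sum_blockInclusion_eq_zero_iff]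

theorem localForm_prolongedForm [IsManifold I 1 N] {x : Fin (ℓ + 1) → N}
    {y : Fin (ℓ + 1) → E} (hy : y ∈ (extChartAt (powModel I ℓ) x).target) :
    localForm (powModel I ℓ) (prolongedForm I ℓ η) x y =
      ∑ a, (blockInclusion ℓ k a).comp ((localForm I η (x a) (y a)).comp
        (ContinuousLinearMap.proj (R := ℝ) (φ := fun _ : Fin (ℓ + 1) => E) a)) := by
  ext1 v
  refine (prolongedForm_apply _ _).trans (Eq.trans ?_ (sum_apply Finset.univ _ _).symm)
  refine Finset.sum_congr rfl fun a _ => ?_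
  exact congrArg (fun u : E => blockInclusion ℓ k a (η ((extChartAt I (x a)).symm (y a)) u))
    (mfderivWithin_extChartAt_pow_symm hy v a)

theorem IsSmoothOneForm.prolongedForm [IsManifold I ∞ N] (hη : IsSmoothOneForm I η) :
    IsSmoothOneForm (powModel I ℓ) (prolongedForm I ℓ η) := by
  have : IsManifold I 1 N := inferInstance
  refine isSmoothOneForm_iff_localForm.2 fun x => ?_
  have h : ContMDiffAt (powModel I ℓ) 𝓘(ℝ, (Fin (ℓ + 1) → E) →L[ℝ] (Fin ((ℓ + 1) * k) → ℝ)) ∞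
      (fun p : Fin (ℓ + 1) → N => ∑ a, (blockInclusion ℓ k a).comp
        ((localForm I η (x a) (extChartAt I (x a) (p a))).comp
        (ContinuousLinearMap.proj (R := ℝ) (φ := fun _ : Fin (ℓ + 1) => E) a))) x := by
    refine contMDiffAt_finsetSum fun a _ => ?_
    have ha : ContMDiffAt (powModel I ℓ) 𝓘(ℝ, E →L[ℝ] (Fin k → ℝ)) ∞
        (fun p : Fin (ℓ + 1) → N => localForm I η (x a) (extChartAt I (x a) (p a))) x :=
      ContMDiffAt.comp x (isSmoothOneForm_iff_localForm.1 hη (x a)) (contMDiff_proj a x)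
    exact contMDiffAt_const.clm_comp (ha.clm_comp contMDiffAt_const)
  refine h.congr_of_eventuallyEq ?_
  filter_upwards [extChartAt_source_mem_nhds (I := powModel I ℓ) x] with p hp
  exact localForm_prolongedForm ((extChartAt (powModel I ℓ) x).map_source hp)

variable [I.Boundaryless]

theorem extDerivOneForm_prolongedForm_apply [IsManifold I ∞ N] (hη : IsSmoothOneForm I η)
    (x : Fin (ℓ + 1) → N) (v w : Fin (ℓ + 1) → E) :
    extDerivOneForm (powModel I ℓ) (prolongedForm I ℓ η) x ![v, w] =
      ∑ a, blockInclusion ℓ k a (extDerivOneForm I η (x a) ![v a, w a]) := by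
  have : IsManifold I 1 N := inferInstance
  have hder : ∀ v w : Fin (ℓ + 1) → E, fderiv ℝ (localForm (powModel I ℓ)
      (KContact.prolongedForm I ℓ η) x) (extChartAt (powModel I ℓ) x x) v w =
      ∑ a, blockInclusion ℓ k a
        (fderiv ℝ (localForm I η (x a)) (extChartAt I (x a) (x a)) (v a) (w a)) := by
    intro v w
    have hd := hη.prolongedForm.differentiableAt_localForm (I := powModel I ℓ) x
    have h1 : HasFDerivAt (fun y => localForm (powModel I ℓ) (KContact.prolongedForm I ℓ η) x y w)
        ((fderiv ℝ (localForm (powModel I ℓ) (KContact.prolongedForm I ℓ η) x)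
          (extChartAt (powModel I ℓ) x x)).flip w) (extChartAt (powModel I ℓ) x x) := by
      simpa using hd.hasFDerivAt.clm_apply (hasFDerivAt_const w _)
    have h2 : HasFDerivAt (fun y : Fin (ℓ + 1) → E =>
        ∑ a, blockInclusion ℓ k a (localForm I η (x a) (y a) (w a)))
        (∑ a, (blockInclusion ℓ k a).comp (((fderiv ℝ (localForm I η (x a))
          (extChartAt I (x a) (x a))).flip (w a)).comp
          (ContinuousLinearMap.proj (R := ℝ) (φ := fun _ : Fin (ℓ + 1) => E) a)))
        (extChartAt (powModel I ℓ) x x) := by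
      refine HasFDerivAt.fun_sum fun a _ => (blockInclusion ℓ k a).hasFDerivAt.comp _ ?_
      have h3 : HasFDerivAt (fun z : E => localForm I η (x a) z (w a))
          ((fderiv ℝ (localForm I η (x a)) (extChartAt I (x a) (x a))).flip (w a))
          (extChartAt I (x a) (x a)) := by
        simpa using (hη.differentiableAt_localForm (x a)).hasFDerivAt.clm_apply
          (hasFDerivAt_const (w a) _)
      exact HasFDerivAt.comp (extChartAt (powModel I ℓ) x x)
        (f := fun y : Fin (ℓ + 1) → E => y a) h3
        (ContinuousLinearMap.proj (R := ℝ) (φ := fun _ : Fin (ℓ + 1) => E) a).hasFDerivAt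
    have h4 := h2.congr_of_eventuallyEq (f₁ := fun y => localForm (powModel I ℓ)
      (KContact.prolongedForm I ℓ η) x y w) (by
        filter_upwards [extChartAt_target_mem_nhds (I := powModel I ℓ) x] with y hy
        rw [localForm_prolongedForm hy]
        exact sum_apply Finset.univ _ _)
    exact (DFunLike.congr_fun (h1.unique h4) v).trans (sum_apply Finset.univ _ _)
  rw [extDerivOneForm_apply hη.prolongedForm, hder, hder, ← Finset.sum_sub_distrib]
  refine Finset.sum_congr rfl fun a _ => ?_
  rw [extDerivOneForm_apply hη, map_sub]

theorem mem_kerExtDeriv_prolongedForm_iff [IsManifold I ∞ N] (hη : IsSmoothOneForm I η)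
    {x : Fin (ℓ + 1) → N} {v : Fin (ℓ + 1) → E} :
    v ∈ kerExtDeriv (powModel I ℓ) (prolongedForm I ℓ η) x ↔
      ∀ a, v a ∈ kerExtDeriv I η (x a) := by
  constructor
  · intro h a w
    let u : Fin (ℓ + 1) → E := Pi.single a (show E from w)
    have h1 := (extDerivOneForm_prolongedForm_apply hη x v u).symm.trans (h u)
    have h2 : u a = w := Pi.single_eq_same (M := fun _ => E) a w
    exact (congrArg (fun z : E => extDerivOneForm I η (x a) ![v a, z]) h2).symm.trans
      (sum_blockInclusion_eq_zero_iff.1 h1 a)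
  · intro h w
    refine (extDerivOneForm_prolongedForm_apply hη x v w).trans ?_
    exact sum_blockInclusion_eq_zero_iff.2 fun a => h a (w a)

end ProlongedForm

section PiSubmodule

variable {ι V : Type*} [Fintype ι] [AddCommGroup V] [Module ℝ V] [FiniteDimensional ℝ V]

theorem finrank_quotient_of_mem_iff_forall (p : ι → Submodule ℝ V) (q : Submodule ℝ (ι → V))
    (h : ∀ v, v ∈ q ↔ ∀ i, v i ∈ p i) :
    Module.finrank ℝ ((ι → V) ⧸ q) = ∑ i, Module.finrank ℝ (V ⧸ p i) := by
  classical
  have hq : q = Submodule.pi Set.univ p := by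
    ext v
    simp [h]
  rw [hq, (Submodule.quotientPi p).finrank_eq, Module.finrank_pi_fintype]

theorem finrank_of_mem_iff_forall (p : ι → Submodule ℝ V) (q : Submodule ℝ (ι → V))
    (h : ∀ v, v ∈ q ↔ ∀ i, v i ∈ p i) :
    Module.finrank ℝ q = ∑ i, Module.finrank ℝ (p i) := by
  have h1 := q.finrank_quotient_add_finrank
  have h2 : ∑ i, (Module.finrank ℝ (V ⧸ p i) + Module.finrank ℝ (p i)) =
      ∑ _i : ι, Module.finrank ℝ V :=
    Finset.sum_congr rfl fun i _ => (p i).finrank_quotient_add_finrank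
  rw [Finset.sum_add_distrib, ← finrank_quotient_of_mem_iff_forall p q h,
    ← Module.finrank_pi_fintype ℝ (M := fun _ : ι => V)] at h2
  omega

end PiSubmodule

section Linear

variable {E : Type*} [NormedAddCommGroup E] [NormedSpace ℝ E] {H : Type*} [TopologicalSpace H]
  {I : ModelWithCorners ℝ E H} {N : Type*} [TopologicalSpace N] [ChartedSpace H N] {ℓ k : ℕ}
  {η : ∀ x : N, TangentSpace I x →L[ℝ] (Fin k → ℝ)}

theorem hamiltonianFunction_diagonalProlongation (Y : ∀ x : N, TangentSpace I x) :
    hamiltonianFunction (powModel I ℓ) (prolongedForm I ℓ η) (diagonalProlongation I ℓ Y) =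
      prolongedFunction ℓ (hamiltonianFunction I η Y) := by
  funext x
  simp only [hamiltonianFunction, prolongedFunction, map_neg, Finset.sum_neg_distrib]
  exact congrArg Neg.neg (prolongedForm_apply x _)

variable (I N ℓ) in
/-- Diagonal prolongation as a linear map. -/
def diagonalProlongationₗ : (∀ x : N, TangentSpace I x) →ₗ[ℝ]
    (∀ x : Fin (ℓ + 1) → N, TangentSpace (powModel I ℓ) x) where
  toFun := diagonalProlongation I ℓ
  map_add' _ _ := rfl
  map_smul' _ _ := rfl

theorem IsLieSystem.isLieAlgebra_smallestLieAlgebra [IsManifold I ∞ N]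
    {X : ℝ → ∀ x : N, TangentSpace I x}
    (hX : IsLieSystem I X) : IsLieAlgebraOfVectorFields I (smallestLieAlgebra I X) := by
  obtain ⟨V, hV, -, hXV⟩ := hX
  refine ⟨fun Y hY => hV.1 Y (Submodule.mem_sInf.1 hY V ⟨hV, hXV⟩), fun Y hY Z hZ => ?_⟩
  refine Submodule.mem_sInf.2 fun W hW => ?_
  exact hW.1.2 Y (Submodule.mem_sInf.1 hY W hW) Z (Submodule.mem_sInf.1 hZ W hW)

end Linear

section Main

variable {E : Type*} [NormedAddCommGroup E] [NormedSpace ℝ E] [FiniteDimensional ℝ E]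
  {H : Type*} [TopologicalSpace H] {I : ModelWithCorners ℝ E H} [I.Boundaryless]
  {N : Type*} [TopologicalSpace N] [ChartedSpace H N] [IsManifold I ∞ N] {ℓ k : ℕ}
  {η : ∀ x : N, TangentSpace I x →L[ℝ] (Fin k → ℝ)}

theorem IsKContactForm.prolongedForm (hη : IsKContactForm I η) :
    IsKContactForm (powModel I ℓ) (prolongedForm I ℓ η) where
  smooth := hη.smooth.prolongedForm
  ker_ne_bot x := by
    obtain ⟨v, hv, hv0⟩ := (Submodule.ne_bot_iff _).1 (hη.ker_ne_bot (x 0))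
    let u : Fin (ℓ + 1) → E := Pi.single 0 (show E from v)
    have hu0 : u 0 = v := Pi.single_eq_same (M := fun _ => E) 0 v
    refine (Submodule.ne_bot_iff _).2 ⟨u, prolongedForm_apply_eq_zero_iff.2 fun a => ?_,
      fun h => hv0 ?_⟩
    · rcases eq_or_ne a 0 with rfl | ha
      · exact (congrArg (fun w : E => η (x 0) w) hu0).trans hv
      · have hua : u a = 0 := Pi.single_eq_of_ne (M := fun _ => E) ha v
        exact (congrArg (fun w : E => η (x a) w) hua).trans (map_zero (η (x a)))
    · exact hu0.symm.trans (congrFun h 0)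
  corank_ker x := by
    let p : Fin (ℓ + 1) → Submodule ℝ E := fun a =>
      show Submodule ℝ E from LinearMap.ker (η (x a) : TangentSpace I (x a) →ₗ[ℝ] (Fin k → ℝ))
    have h := finrank_quotient_of_mem_iff_forall p
      (LinearMap.ker (KContact.prolongedForm I ℓ η x :
        TangentSpace (powModel I ℓ) x →ₗ[ℝ] (Fin ((ℓ + 1) * k) → ℝ)))
      fun v => prolongedForm_apply_eq_zero_iff
    refine h.trans ((Finset.sum_congr rfl fun a _ => hη.corank_ker (x a)).trans ?_)
    simp
  rank_kerExtDeriv x := by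
    let p : Fin (ℓ + 1) → Submodule ℝ E := fun a =>
      show Submodule ℝ E from kerExtDeriv I η (x a)
    have h := finrank_of_mem_iff_forall p
      (kerExtDeriv (powModel I ℓ) (KContact.prolongedForm I ℓ η) x)
      fun v => mem_kerExtDeriv_prolongedForm_iff hη.smooth
    refine h.trans ((Finset.sum_congr rfl fun a _ => hη.rank_kerExtDeriv (x a)).trans ?_)
    simp
  ker_inf_kerExtDeriv x := by
    refine (Submodule.eq_bot_iff _).2 fun v hv => funext fun a => ?_
    have h1 := prolongedForm_apply_eq_zero_iff.1 hv.1 a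
    have h2 := (mem_kerExtDeriv_prolongedForm_iff hη.smooth).1 hv.2 a
    exact (Submodule.eq_bot_iff _).1 (hη.ker_inf_kerExtDeriv (x a)) _ ⟨h1, h2⟩

/-- If `Z` takes values in the kernel of the prolonged form, the derivatives of its `a`-th component
in the directions of the other factors stay in `ker η`. -/
theorem apply_fderiv_localField_eq_zero
    {Z : ∀ x : Fin (ℓ + 1) → N, TangentSpace (powModel I ℓ) x}
    (hZ : IsSmoothVectorField (powModel I ℓ) Z) (hker : ∀ x, prolongedForm I ℓ η x (Z x) = 0)
    (x : Fin (ℓ + 1) → N) {a : Fin (ℓ + 1)} {u : Fin (ℓ + 1) → E} (hu : u a = 0) :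
    η (x a) (fderiv ℝ (localField (powModel I ℓ) Z x) (extChartAt (powModel I ℓ) x x) u a) = 0 := by
  have : IsManifold I 1 N := inferInstance
  set y₀ := extChartAt (powModel I ℓ) x x
  let L : (Fin (ℓ + 1) → E) →L[ℝ] (Fin k → ℝ) := (show E →L[ℝ] (Fin k → ℝ) from η (x a)).comp
    (ContinuousLinearMap.proj (R := ℝ) (φ := fun _ : Fin (ℓ + 1) => E) a)
  have hline : HasDerivAt (fun s : ℝ => y₀ + s • u) u 0 := by
    simpa using ((hasDerivAt_id (0 : ℝ)).smul_const u).const_add y₀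
  have hd : HasFDerivAt (localField (powModel I ℓ) Z x)
      (fderiv ℝ (localField (powModel I ℓ) Z x) y₀) (y₀ + (0 : ℝ) • u) := by
    rw [zero_smul, add_zero]
    exact (hZ.differentiableAt_localField x).hasFDerivAt
  have hcomp : HasDerivAt (fun s : ℝ => localField (powModel I ℓ) Z x (y₀ + s • u))
      (fderiv ℝ (localField (powModel I ℓ) Z x) y₀ u) 0 :=
    HasFDerivAt.comp_hasDerivAt (f := fun s : ℝ => y₀ + s • u) (0 : ℝ) hd hline
  have h1 : HasDerivAt (fun s : ℝ => L (localField (powModel I ℓ) Z x (y₀ + s • u)))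
      (L (fderiv ℝ (localField (powModel I ℓ) Z x) y₀ u)) 0 :=
    L.hasFDerivAt.comp_hasDerivAt (0 : ℝ) hcomp
  have ht : (extChartAt (powModel I ℓ) x).target ∈ 𝓝 (y₀ + (0 : ℝ) • u) := by
    rw [zero_smul, add_zero]
    exact extChartAt_target_mem_nhds x
  have h2 : (fun s : ℝ => L (localField (powModel I ℓ) Z x (y₀ + s • u))) =ᶠ[𝓝 0] fun _ => 0 := by
    filter_upwards [hline.continuousAt ht] with s hs
    have hpt : (extChartAt I (x a)).symm ((y₀ + s • u) a) = x a := by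
      rw [Pi.add_apply, Pi.smul_apply, hu, smul_zero, add_zero]
      exact extChartAt_to_inv (x a)
    have hη : ∀ p, p = x a → ∀ w : E,
        η (x a) (mfderiv I 𝓘(ℝ, E) (extChartAt I (x a)) p w : E) = η p w := by
      rintro p rfl w
      rw [mfderiv_extChartAt_self]
      rfl
    exact (congrArg (fun w : E => η (x a) w) (localField_pow_apply Z hs a)).trans
      ((hη _ hpt _).trans (prolongedForm_apply_eq_zero_iff.1
        (hker ((extChartAt (powModel I ℓ) x).symm (y₀ + s • u))) a))
  exact (h2.hasDerivAt_iff.1 h1).unique (hasDerivAt_const (0 : ℝ) (0 : Fin k → ℝ))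

theorem IsHamiltonianVectorField.diagonalProlongation {Y : ∀ x : N, TangentSpace I x}
    (hY : IsHamiltonianVectorField I η Y) :
    IsHamiltonianVectorField (powModel I ℓ) (prolongedForm I ℓ η)
      (diagonalProlongation I ℓ Y) := by
  refine ⟨hY.1.diagonalProlongation, fun Z hZ hker x =>
    prolongedForm_apply_eq_zero_iff.2 fun a => ?_⟩
  have h1 := hY.2 (sliceField Z x a) (hZ.sliceField x a) (fun p => by
    have h := prolongedForm_apply_eq_zero_iff.1 (hker (Function.update x a p)) a
    have hp : ∀ q, q = p → ∀ w : E, η q w = 0 → η p w = 0 := by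
      rintro q rfl w hw
      exact hw
    exact hp _ (Function.update_self a p x) _ h) (x a)
  have h2 := apply_fderiv_localField_eq_zero hZ hker x (a := a)
    (u := Function.update (KContact.diagonalProlongation I ℓ Y x : Fin (ℓ + 1) → E) a 0)
    (Function.update_self (β := fun _ => E) a 0 _)
  refine (congrArg (fun w : E => η (x a) w)
    (mlieBracket_diagonalProlongation_apply hY.1 hZ x a)).trans ?_
  exact (map_add (η (x a)) _ _).trans ((congrArg₂ (· + ·) h1 h2).trans (add_zero 0))

theorem IsLieAlgebraOfVectorFields.map_diagonalProlongation
    {V : Submodule ℝ (∀ x : N, TangentSpace I x)} (hV : IsLieAlgebraOfVectorFields I V) :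
    IsLieAlgebraOfVectorFields (powModel I ℓ) (V.map (diagonalProlongationₗ I N ℓ)) := by
  constructor
  · rintro _ ⟨Y, hY, rfl⟩
    exact (hV.1 Y hY).diagonalProlongation
  · rintro _ ⟨Y, hY, rfl⟩ _ ⟨Z, hZ, rfl⟩
    exact ⟨_, hV.2 Y hY Z hZ, (mlieBracket_diagonalProlongation (hV.1 Y hY) (hV.1 Z hZ)).symm⟩

theorem IsLieSystem.diagonalProlongation {X : ℝ → ∀ x : N, TangentSpace I x}
    (hX : IsLieSystem I X) :
    IsLieSystem (powModel I ℓ) (fun t => diagonalProlongation I ℓ (X t)) := by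
  obtain ⟨V, hV, hfin, hXV⟩ := hX
  exact ⟨V.map (diagonalProlongationₗ I N ℓ), hV.map_diagonalProlongation,
    inferInstance, fun t => ⟨X t, hXV t, rfl⟩⟩

theorem IsLieSystem.smallestLieAlgebra_diagonalProlongation_le
    {X : ℝ → ∀ x : N, TangentSpace I x} (hX : IsLieSystem I X) :
    smallestLieAlgebra (powModel I ℓ) (fun t => KContact.diagonalProlongation I ℓ (X t)) ≤
      (smallestLieAlgebra I X).map (diagonalProlongationₗ I N ℓ) :=
  sInf_le ⟨hX.isLieAlgebra_smallestLieAlgebra.map_diagonalProlongation, fun t =>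
    ⟨X t, Submodule.mem_sInf.2 fun _ hW => hW.2 t, rfl⟩⟩

theorem IsKContactLieSystem.diagonalProlongation {X : ℝ → ∀ x : N, TangentSpace I x}
    (hX : IsKContactLieSystem I η X) :
    IsKContactLieSystem (powModel I ℓ) (prolongedForm I ℓ η)
      (fun t => diagonalProlongation I ℓ (X t)) where
  isKContactForm := hX.isKContactForm.prolongedForm
  isLieSystem := hX.isLieSystem.diagonalProlongation
  isHamiltonian Z hZ := by
    obtain ⟨Y, hY, rfl⟩ := hX.isLieSystem.smallestLieAlgebra_diagonalProlongation_le hZ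
    exact (hX.isHamiltonian Y hY).diagonalProlongation

end Main

end KContact

end

theorem mainTheorem1
    {E : Type*} [NormedAddCommGroup E] [NormedSpace ℝ E] [FiniteDimensional ℝ E]
    {H : Type*} [TopologicalSpace H] (I : ModelWithCorners ℝ E H) [I.Boundaryless]
    {N : Type*} [TopologicalSpace N] [T2Space N] [ChartedSpace H N] [IsManifold I ∞ N]
    {k : ℕ} (η : ∀ x : N, TangentSpace I x →L[ℝ] (Fin k → ℝ))
    (X : ℝ → ∀ x : N, TangentSpace I x)
    (hX : KContact.IsKContactLieSystem I η X) (ℓ : ℕ) :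
    KContact.IsKContactForm (KContact.powModel I ℓ) (KContact.prolongedForm I ℓ η) ∧
    (∀ Y : (∀ x : N, TangentSpace I x), KContact.IsHamiltonianVectorField I η Y →
      KContact.IsHamiltonianVectorField (KContact.powModel I ℓ) (KContact.prolongedForm I ℓ η)
        (KContact.diagonalProlongation I ℓ Y) ∧
      KContact.hamiltonianFunction (KContact.powModel I ℓ) (KContact.prolongedForm I ℓ η)
          (KContact.diagonalProlongation I ℓ Y) =
        KContact.prolongedFunction ℓ (KContact.hamiltonianFunction I η Y)) ∧
    KContact.IsKContactLieSystem (KContact.powModel I ℓ) (KContact.prolongedForm I ℓ η)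
      (fun t => KContact.diagonalProlongation I ℓ (X t)) ∧
    (ContMDiff (𝓘(ℝ, ℝ).prod I) I.tangent ∞
        (fun p : ℝ × N => (⟨p.2, X p.1 p.2⟩ : TangentBundle I N)) →
      ContMDiff (𝓘(ℝ, ℝ).prod (KContact.powModel I ℓ)) (KContact.powModel I ℓ).tangent ∞
        (fun p : ℝ × (Fin (ℓ + 1) → N) =>
          (⟨p.2, KContact.diagonalProlongation I ℓ (X p.1) p.2⟩ :
            TangentBundle (KContact.powModel I ℓ) (Fin (ℓ + 1) → N)))) := by
  refine ⟨hX.isKContactForm.prolongedForm, fun Y hY =>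
    ⟨hY.diagonalProlongation, KContact.hamiltonianFunction_diagonalProlongation Y⟩,
    hX.diagonalProlongation, fun h => KContact.contMDiff_tangentBundle_pow fun a => ?_⟩
  have hp : ContMDiff (𝓘(ℝ, ℝ).prod (KContact.powModel I ℓ)) (𝓘(ℝ, ℝ).prod I) ∞
      (fun p : ℝ × (Fin (ℓ + 1) → N) => (p.1, p.2 a)) :=
    contMDiff_fst.prodMk ((KContact.contMDiff_proj a).comp contMDiff_snd)
  exact h.comp hp
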